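/- **Setting.** Let $D\subset\mathbb R^2$ be a bounded open set, $(\cdot,\cdot)$ and $\|\cdot\|$ the $L^2(D)$ inner product and norm (of scalar, vector or matrix fields), and $X=[H^1_0(D)]^2$. Let $\mathscr T_h$ be a finite conforming triangulation of $\overline D$ and $r\ge 1$ an integer. Put $$X_h=\{v\in [C^0(\overline D)]^2\cap X: v|_K\in [P_{r+1}(K)]^2\ \forall K\in\mathscr T_h\},\qquad Q_h=\{q\in C^0(\overline D)\cap L^2(D): q|_K\in P_r(K)\ \forall K\in\mathscr T_h\},$$ $$V_h=\{v\in X_h:(\nabla\cdot v,q)=0\ \forall q\in Q_h\},\qquad b(u,v,w)=\tfrac12(u\cdot\nabla v,w)-\tfrac12(u\cdot\nabla w,v).$$ Let $\theta\in[0,1]$, $0=t_0<t_1<\dots<t_M=T$, $k_n=t_{n+1}-t_n$, and for $1\le n\le M-1$ let $\varepsilon_n=\frac{k_n-k_{n-1}}{k_n+k_{n-1}}$. Set $\alpha_2=\frac{\theta+1}2$, $\alpha_1=-\theta$, $\alpha_0=\frac{\theta-1}2$, $\widehat k_n=\alpha_2k_n-\alpha_0k_{n-1}$, $$\beta^{(n)}_{2}=\tfrac14\Big(1+\tfrac{1-\theta^2}{(1+\varepsilon_n\theta)^2}+\varepsilon_n^2\tfrac{\theta(1-\theta^2)}{(1+\varepsilon_n\theta)^2}+\theta\Big),\quad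 \beta^{(n)}_1=\tfrac12\Big(1-\tfrac{1-\theta^2}{(1+\varepsilon_n\theta)^2}\Big),$$ $$\beta^{(n)}_{0}=\tfrac14\Big(1+\tfrac{1-\theta^2}{(1+\varepsilon_n\theta)^2}-\varepsilon_n^2\tfrac{\theta(1-\theta^2)}{(1+\varepsilon_n\theta)^2}-\theta\Big),$$ $$a_1^{(n)}=-\tfrac{\sqrt{\theta(1-\theta^2)}}{\sqrt2(1+\varepsilon_n\theta)},\quad a_2^{(n)}=-\tfrac{1-\varepsilon_n}2a_1^{(n)},\quad a_0^{(n)}=-\tfrac{1+\varepsilon_n}2a_1^{(n)},\qquad C_\beta^{(n)}=\sum_{\ell=0}^2(\beta_\ell^{(n)})^2,$$ and for a sequence $z_n$ write $z_{n,\alpha}=\sum_{\ell=0}^2\alpha_\ell z_{n-1+\ell}$, $z_{n,\beta}=\sum_{\ell=0}^2\beta^{(n)}_\ell z_{n-1+\ell}$. Let $\mu>0$, $\gamma,\nu,\lambda\ge0$, $\rho\in\mathbb R$, let $f\in L^2([0,T];[L^2(D)]^2)$ be given pointwise in time, and $f_n=f(t_n)$. Let $(u_n^h,w_n^h,p_n^h)\in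 X_h\times V_h\times Q_h$, $0\le n\le M$, solve the fully discrete scheme: for $n=1,\dots,M-1$ and all $(v^h,\varphi^h,q^h)\in X_h\times V_h\times Q_h$, $$\tfrac1{\widehat k_n}(u_{n,\alpha}^h,v^h)+\mu(\nabla u_{n,\beta}^h,\nabla v^h)+\gamma(\nabla w^h_{n,\beta},\nabla v^h)+\nu b(u^h_{n,\beta},u^h_{n,\beta},v^h)+\rho(u^h_{n,\beta},v^h)+\lambda(|u^h_{n,\beta}|^2u^h_{n,\beta},v^h)-(p^h_{n,\beta},\nabla\cdot v^h)=(f_{n,\beta},v^h),$$ $$(w_{n+1}^h,\varphi^h)=(\nabla u_{n+1}^h,\nabla\varphi^h),\qquad(\nabla\cdot u^h_{n+1},q^h)=0,$$ and let the starting values also satisfy $(w_{n}^h,\varphi^h)=(\nabla u_{n}^h,\nabla\varphi^h)$ and $(\nabla\cdot u^h_{n},q^h)=0$ for $n=0,1$ and all $\varphi^h\in V_h$, $q^h\in Q_h$. **Theorem (Boundedness in kinetic energy).** There are a constant $C(\theta)>0$ depending only on $\theta$ and a constant $C>0$ depending only on $D$ such that, in the above setting, if $$C_\beta^{(n)}|\rho|\,\widehat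 k_n\le\frac{1+\theta}4\qquad(n=1,\dots,M-1),$$ then for all $1<m\le M$ $$\frac{1+\theta}4\|u_m^h\|^2+\sum_{n=1}^{m-1}\Big[\Big\|\sum_{\ell=0}^2a_\ell^{(n)}u^h_{n-1+\ell}\Big\|^2+\widehat k_n\Big(\frac\mu2\|\nabla u^h_{n,\beta}\|^2+\gamma\|w^h_{n,\beta}\|^2+\lambda\|u^h_{n,\beta}\|_{L^4}^4\Big)\Big]$$ $$\le\exp\big(C(\theta)|\rho|T\big)\Big(\frac{1+\theta}4\|u_1^h\|^2+\frac{1+\theta}4\|u_0^h\|^2+\frac C\mu\sum_{n=1}^{m-1}\widehat k_n\|f_{n,\beta}\|^2\Big).$$ -/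

import Mathlib

open MeasureTheory
open scoped ContDiff

namespace ActiveFluid

/-- The plane `ℝ²` with its Euclidean norm. -/
abbrev Plane : Type := EuclideanSpace ℝ (Fin 2)

/-- `2 × 2` arrays with the Frobenius inner product; the entry `(i, j)` of a gradient is `∂ⱼ vᵢ`. -/
abbrev Grad : Type := EuclideanSpace ℝ (Fin 2 × Fin 2)

/-! ### Lebesgue and Sobolev spaces -/

/-- The `L²(D)` inner product of scalar, vector or gradient fields. -/
noncomputable def ip {F : Type*} [NormedAddCommGroup F] [InnerProductSpace ℝ F]
    (D : Set Plane) (u v : Plane → F) : ℝ :=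
  ∫ x in D, inner ℝ (u x) (v x)

/-- `‖u‖²`, the square of the `L²(D)` norm. -/
noncomputable def normSq {F : Type*} [NormedAddCommGroup F] [InnerProductSpace ℝ F]
    (D : Set Plane) (u : Plane → F) : ℝ :=
  ∫ x in D, ‖u x‖ ^ 2

/-- `‖u‖⁴` in `L⁴(D)`. -/
noncomputable def l4NormPow (D : Set Plane) (u : Plane → Plane) : ℝ :=
  ∫ x in D, ‖u x‖ ^ 4

/-- `φ` is smooth with compact support contained in `D`. -/
def IsTestFunction {F : Type*} [NormedAddCommGroup F] [NormedSpace ℝ F]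
    (D : Set Plane) (φ : Plane → F) : Prop :=
  ContDiff ℝ ∞ φ ∧ HasCompactSupport φ ∧ tsupport φ ⊆ D

/-- `G` is the weak (distributional) gradient of `v` on `D`. -/
def HasWeakGrad (D : Set Plane) (v : Plane → Plane) (G : Plane → Grad) : Prop :=
  LocallyIntegrableOn v D ∧ LocallyIntegrableOn G D ∧
    ∀ φ : Plane → ℝ, IsTestFunction D φ → ∀ i j : Fin 2,
      ∫ x in D, v x i * fderiv ℝ φ x (EuclideanSpace.single j 1) = - ∫ x in D, G x (i, j) * φ x

open Classical in
/-- The weak gradient `∇v` on `D` (unique almost everywhere; `0` if there is none). -/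
noncomputable def grad (D : Set Plane) (v : Plane → Plane) : Plane → Grad :=
  if h : ∃ G, HasWeakGrad D v G then h.choose else 0

/-- The classical gradient of a differentiable field. -/
noncomputable def classicalGrad (v : Plane → Plane) : Plane → Grad :=
  fun x => WithLp.toLp 2 fun ij => fderiv ℝ v x (EuclideanSpace.single ij.2 1) ij.1

/-- `v ∈ [H¹(D)]²`. -/
def MemH1 (D : Set Plane) (v : Plane → Plane) : Prop :=
  MemLp v 2 (volume.restrict D) ∧ (∃ G, HasWeakGrad D v G) ∧
    MemLp (grad D v) 2 (volume.restrict D)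

/-- `v ∈ X`: the fields in `[H¹(D)]²` that vanish on `∂D`, that is, `[H¹₀(D)]²`, the closure of
the test fields in the `H¹` norm. -/
def MemX (D : Set Plane) (v : Plane → Plane) : Prop :=
  MemH1 D v ∧ ∀ ε > (0 : ℝ), ∃ φ : Plane → Plane, IsTestFunction D φ ∧
    eLpNorm (v - φ) 2 (volume.restrict D) < ENNReal.ofReal ε ∧
    eLpNorm (grad D v - classicalGrad φ) 2 (volume.restrict D) < ENNReal.ofReal ε

/-- The divergence `∇ · v` on `D`. -/
noncomputable def div (D : Set Plane) (v : Plane → Plane) : Plane → ℝ :=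
  fun x => ∑ i : Fin 2, grad D v x (i, i)

/-- The convective derivative `(u · ∇) v` on `D`. -/
noncomputable def conv (D : Set Plane) (u v : Plane → Plane) : Plane → Plane :=
  fun x => WithLp.toLp 2 fun i => ∑ j : Fin 2, u x j * grad D v x (i, j)

/-- The skew-symmetric trilinear form `b(u, v, w)`. -/
noncomputable def b (D : Set Plane) (u v w : Plane → Plane) : ℝ :=
  1 / 2 * ip D (conv D u v) w - 1 / 2 * ip D (conv D u w) v

/-! ### Finite element spaces -/

/-- The triangles of a simplicial complex in the plane, given by their vertex sets. -/
def triangles (𝒯 : Geometry.SimplicialComplex ℝ Plane) : Set (Finset Plane) :=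
  {s | s ∈ 𝒯.faces ∧ s.card = 3}

/-- `𝒯` is a (conforming, finite) triangulation of the closure of `D`. -/
def IsTriangulation (D : Set Plane) (𝒯 : Geometry.SimplicialComplex ℝ Plane) : Prop :=
  𝒯.faces.Finite ∧ closure D = ⋃ s ∈ triangles 𝒯, convexHull ℝ (s : Set Plane)

/-- On the set `K`, the function `q` is a polynomial of total degree at most `k`. -/
def IsPolyOn (k : ℕ) (K : Set Plane) (q : Plane → ℝ) : Prop :=
  ∃ P : MvPolynomial (Fin 2) ℝ, P.totalDegree ≤ k ∧
    ∀ x ∈ K, q x = MvPolynomial.eval (fun j => x j) P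

/-- `v ∈ X_h`: continuous on the closure of `D`, in `X`, piecewise polynomial of degree `≤ r + 1`. -/
def MemXh (D : Set Plane) (𝒯 : Geometry.SimplicialComplex ℝ Plane) (r : ℕ)
    (v : Plane → Plane) : Prop :=
  ContinuousOn v (closure D) ∧ MemX D v ∧
    ∀ s ∈ triangles 𝒯, ∀ i : Fin 2, IsPolyOn (r + 1) (convexHull ℝ (s : Set Plane)) fun x => v x i

/-- `q ∈ Q_h`: continuous on the closure of `D`, in `L²(D)`, piecewise polynomial of degree `≤ r`. -/
def MemQh (D : Set Plane) (𝒯 : Geometry.SimplicialComplex ℝ Plane) (r : ℕ)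
    (q : Plane → ℝ) : Prop :=
  ContinuousOn q (closure D) ∧ MemLp q 2 (volume.restrict D) ∧
    ∀ s ∈ triangles 𝒯, IsPolyOn r (convexHull ℝ (s : Set Plane)) q

/-- `v ∈ V_h`: the discretely divergence-free members of `X_h`. -/
def MemVh (D : Set Plane) (𝒯 : Geometry.SimplicialComplex ℝ Plane) (r : ℕ)
    (v : Plane → Plane) : Prop :=
  MemXh D 𝒯 r v ∧ ∀ q, MemQh D 𝒯 r q → ip D (div D v) q = 0

/-! ### The variable-step DLN method -/

/-- `0 = t₀ < t₁ < ⋯ < t_M = T`. -/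
def IsTimeGrid (T : ℝ) (M : ℕ) (t : ℕ → ℝ) : Prop :=
  t 0 = 0 ∧ t M = T ∧ ∀ n < M, t n < t (n + 1)

/-- The time step `k_n = t_{n+1} - t_n`. -/
def step (t : ℕ → ℝ) (n : ℕ) : ℝ := t (n + 1) - t n

/-- The step variability `ε_n`, for `n ≥ 1`. -/
noncomputable def variability (t : ℕ → ℝ) (n : ℕ) : ℝ :=
  (step t n - step t (n - 1)) / (step t n + step t (n - 1))

/-- The coefficients `(α₀, α₁, α₂)`. -/
noncomputable def α (θ : ℝ) : Fin 3 → ℝ := ![(θ - 1) / 2, -θ, (θ + 1) / 2]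

/-- The coefficients `(β₀, β₁, β₂)` for the step variability `ε`. -/
noncomputable def β (θ ε : ℝ) : Fin 3 → ℝ :=
  ![1 / 4 * (1 + (1 - θ ^ 2) / (1 + ε * θ) ^ 2
      - ε ^ 2 * (θ * (1 - θ ^ 2) / (1 + ε * θ) ^ 2) - θ),
    1 / 2 * (1 - (1 - θ ^ 2) / (1 + ε * θ) ^ 2),
    1 / 4 * (1 + (1 - θ ^ 2) / (1 + ε * θ) ^ 2
      + ε ^ 2 * (θ * (1 - θ ^ 2) / (1 + ε * θ) ^ 2) + θ)]

/-- The numerical dissipation coefficient `a₁` for the step variability `ε`. -/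
noncomputable def a₁ (θ ε : ℝ) : ℝ :=
  -(√(θ * (1 - θ ^ 2)) / (√2 * (1 + ε * θ)))

/-- The numerical dissipation coefficients `(a₀, a₁, a₂)` for the step variability `ε`. -/
noncomputable def a (θ ε : ℝ) : Fin 3 → ℝ :=
  ![-((1 + ε) / 2) * a₁ θ ε, a₁ θ ε, -((1 - ε) / 2) * a₁ θ ε]

/-- The weighted average time step `k̂_n = α₂ k_n - α₀ k_{n-1}`, for `n ≥ 1`. -/
noncomputable def avgStep (θ : ℝ) (t : ℕ → ℝ) (n : ℕ) : ℝ :=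
  α θ 2 * step t n - α θ 0 * step t (n - 1)

/-- `∑_{ℓ = 0}^{2} c_ℓ z_{n-1+ℓ}`, for `n ≥ 1`. -/
def comb {F : Type*} [AddCommGroup F] [Module ℝ F] (c : Fin 3 → ℝ) (z : ℕ → F) (n : ℕ) : F :=
  ∑ l : Fin 3, c l • z (n - 1 + l)

/-- `z_{n,α}`. -/
noncomputable def atα {F : Type*} [AddCommGroup F] [Module ℝ F]
    (θ : ℝ) (z : ℕ → F) (n : ℕ) : F :=
  comb (α θ) z n

/-- `z_{n,β}`. -/
noncomputable def atβ {F : Type*} [AddCommGroup F] [Module ℝ F]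
    (θ : ℝ) (t : ℕ → ℝ) (z : ℕ → F) (n : ℕ) : F :=
  comb (β θ (variability t n)) z n

/-- `C_β^{(n)}`, the sum of the squares of the coefficients `β_ℓ^{(n)}`. -/
noncomputable def Cβ (θ : ℝ) (t : ℕ → ℝ) (n : ℕ) : ℝ :=
  ∑ l : Fin 3, β θ (variability t n) l ^ 2

/-! ### The fully discrete scheme -/

/-- The parameters of the active fluid equations. -/
structure Params where
  μ : ℝ
  γ : ℝ
  ν : ℝ
  ρ : ℝ
  lam : ℝ

/-- The auxiliary field `w ∈ V_h` belongs to `u`: `(w, φ) = (∇u, ∇φ)` for all `φ ∈ V_h`. -/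
def AuxEq (D : Set Plane) (𝒯 : Geometry.SimplicialComplex ℝ Plane) (r : ℕ)
    (u w : Plane → Plane) : Prop :=
  ∀ φ, MemVh D 𝒯 r φ → ip D w φ = ip D (grad D u) (grad D φ)

/-- `u` is discretely divergence-free: `(∇ · u, q) = 0` for all `q ∈ Q_h`. -/
def DivEq (D : Set Plane) (𝒯 : Geometry.SimplicialComplex ℝ Plane) (r : ℕ)
    (u : Plane → Plane) : Prop :=
  ∀ q, MemQh D 𝒯 r q → ip D (div D u) q = 0

/-- The momentum equation of the scheme at the step `n`, tested with all `v ∈ X_h`. -/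
def MomentumEq (P : Params) (D : Set Plane) (𝒯 : Geometry.SimplicialComplex ℝ Plane) (r : ℕ)
    (θ : ℝ) (t : ℕ → ℝ) (f : ℝ → Lp Plane 2 (volume.restrict D))
    (u w : ℕ → Plane → Plane) (p : ℕ → Plane → ℝ) (n : ℕ) : Prop :=
  ∀ v, MemXh D 𝒯 r v →
    1 / avgStep θ t n * ip D (atα θ u n) v
      + P.μ * ip D (grad D (atβ θ t u n)) (grad D v)
      + P.γ * ip D (grad D (atβ θ t w n)) (grad D v)
      + P.ν * b D (atβ θ t u n) (atβ θ t u n) v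
      + P.ρ * ip D (atβ θ t u n) v
      + P.lam * ip D (fun x => ‖atβ θ t u n x‖ ^ 2 • atβ θ t u n x) v
      - ip D (atβ θ t p n) (div D v)
    = ip D (atβ (F := Lp Plane 2 (volume.restrict D)) θ t (fun j => f (t j)) n) v

/-- `(u_n, w_n, p_n)`, `0 ≤ n ≤ M`, is a discrete solution: all members lie in
`X_h × V_h × Q_h`, and for `n = 1, …, M - 1` the step from `n - 1, n` to `n + 1` solves the
fully discrete equations. -/
structure IsSolution (P : Params) (D : Set Plane) (𝒯 : Geometry.SimplicialComplex ℝ Plane) (r : ℕ)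
    (θ : ℝ) (M : ℕ) (t : ℕ → ℝ) (f : ℝ → Lp Plane 2 (volume.restrict D))
    (u w : ℕ → Plane → Plane) (p : ℕ → Plane → ℝ) : Prop where
  mem_u : ∀ n ≤ M, MemXh D 𝒯 r (u n)
  mem_w : ∀ n ≤ M, MemVh D 𝒯 r (w n)
  mem_p : ∀ n ≤ M, MemQh D 𝒯 r (p n)
  momentum : ∀ n, 1 ≤ n → n < M → MomentumEq P D 𝒯 r θ t f u w p n
  aux : ∀ n, 1 ≤ n → n < M → AuxEq D 𝒯 r (u (n + 1)) (w (n + 1))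
  divFree : ∀ n, 1 ≤ n → n < M → DivEq D 𝒯 r (u (n + 1))

/-- The two starting levels satisfy the discrete constraints, as those produced by the
Stokes-type projection and an implicit one-step start do. -/
def CompatibleStart (D : Set Plane) (𝒯 : Geometry.SimplicialComplex ℝ Plane) (r : ℕ)
    (u w : ℕ → Plane → Plane) : Prop :=
  ∀ n ≤ 1, AuxEq D 𝒯 r (u n) (w n) ∧ DivEq D 𝒯 r (u n)

end ActiveFluid

/-!
The estimate is an energy argument: the momentum equation is tested with `u_{n,β}`.

* The time difference is handled by the `G`-stability of the method (`inner_comb_α_comb_β`):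
  `(u_{n,α}, u_{n,β}) = E_{n+1} - E_n + ‖∑ a_ℓ u_{n-1+ℓ}‖²` with the energy
  `E_n = (1+θ)/4 ‖u_n‖² + (1-θ)/4 ‖u_{n-1}‖²`. This is an identity in any inner product space and
  is applied in the Hilbert space `L²(D)`.
* The convective term vanishes because `b` is skew-symmetric, the pressure term because `u_{n,β}` is
  discretely divergence-free, and the `γ`-term is `γ ‖w_{n,β}‖²` because `w_{n,β} ∈ V_h` may be
  used in the auxiliary equation. Both use that the discrete spaces and constraints are linear,
  which rests on the almost everywhere uniqueness of weak gradients (`HasWeakGrad.ae_eq`).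
* The forcing is absorbed into half of the viscous term by the Poincaré inequality on `X`
  (`exists_normSq_le_grad`). For test fields the latter follows from the Sobolev inequality
  `‖φ‖_{L²} ≤ C ‖∇φ‖_{L¹}` of the plane.

What remains on the right of `energy_step` is `|ρ| k̂_n ‖u_{n,β}‖²`, whose part at the level `n + 1`
is implicit. The step restriction is not strict, so the crude bound
`‖u_{n,β}‖² ≤ C_β ∑ ‖u_{n-1+ℓ}‖²` could use up all of `E_{n+1}`. However `β₂² ≤ κ C_β` with some
`κ = κ(θ) < 1` that does not depend on the step variability (`exists_β_bound`), so Young's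
inequality with suitable weights leaves a fixed fraction of `E_{n+1}` (`exists_absorb`). The
discrete Gronwall inequality (`discrete_gronwall`) then gives the exponential factor, with
`∑ k̂_n ≤ T` since the averaged steps telescope.
-/

namespace ActiveFluid

/-! ### Coefficients of the method -/

theorem one_add_variability_mul_pos {θ ε : ℝ} (hθ0 : 0 ≤ θ) (hθ1 : θ ≤ 1) (hε : -1 < ε) :
    0 < 1 + ε * θ := by
  rcases hθ1.lt_or_eq with h | h
  · nlinarith
  · subst h; linarith

theorem norm_comb_sq {E : Type*} [NormedAddCommGroup E] [InnerProductSpace ℝ E]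
    (a b c : ℝ) (x y z : E) :
    ‖a • x + b • y + c • z‖ ^ 2 = a ^ 2 * ‖x‖ ^ 2 + b ^ 2 * ‖y‖ ^ 2 + c ^ 2 * ‖z‖ ^ 2
      + 2 * (a * b * inner ℝ x y + a * c * inner ℝ x z + b * c * inner ℝ y z) := by
  rw [← real_inner_self_eq_norm_sq, ← real_inner_self_eq_norm_sq x,
    ← real_inner_self_eq_norm_sq y, ← real_inner_self_eq_norm_sq z]
  simp only [inner_add_left, inner_add_right, real_inner_smul_left, real_inner_smul_right,
    real_inner_comm x y, real_inner_comm x z, real_inner_comm y z]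
  ring

/-- The `G`-stability identity of the method, for vectors of an inner product space. -/
theorem inner_comb_α_comb_β {E : Type*} [NormedAddCommGroup E] [InnerProductSpace ℝ E]
    {θ ε : ℝ} (hθ0 : 0 ≤ θ) (hθ1 : θ ≤ 1) (hε : -1 < ε) (z : ℕ → E) {n : ℕ} (hn : 1 ≤ n) :
    inner ℝ (comb (α θ) z n) (comb (β θ ε) z n)
      = ((1 + θ) / 4 * ‖z (n + 1)‖ ^ 2 + (1 - θ) / 4 * ‖z n‖ ^ 2)
        - ((1 + θ) / 4 * ‖z n‖ ^ 2 + (1 - θ) / 4 * ‖z (n - 1)‖ ^ 2)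
        + ‖comb (a θ ε) z n‖ ^ 2 := by
  have hpos := (one_add_variability_mul_pos hθ0 hθ1 hε).ne'
  -- all coefficients are polynomials in `θ`, `ε` and `s`, tied by the single relation `hs`
  obtain ⟨s, hsdef⟩ : ∃ s, s = (1 - θ ^ 2) / (1 + ε * θ) ^ 2 := ⟨_, rfl⟩
  have hs : s * (1 + ε * θ) ^ 2 = 1 - θ ^ 2 := by
    rw [hsdef, div_mul_cancel₀ _ (pow_ne_zero 2 hpos)]
  have ha : a₁ θ ε ^ 2 = θ * s / 2 := by
    have h : 0 ≤ θ * (1 - θ ^ 2) := mul_nonneg hθ0 (by nlinarith)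
    rw [a₁, neg_sq, div_pow, mul_pow, Real.sq_sqrt h, Real.sq_sqrt zero_le_two, hsdef,
      mul_comm (2 : ℝ), ← div_div, mul_div_assoc]
  obtain ⟨k, rfl⟩ : ∃ k, n = k + 1 := ⟨n - 1, by omega⟩
  have e : k + 1 - 1 = k := by omega
  simp only [comb, Fin.sum_univ_three, α, β, a, e, Matrix.cons_val_zero, Matrix.cons_val_one,
    Matrix.cons_val, Fin.val_zero, Fin.val_one, Fin.val_two, add_zero]
  rw [norm_comb_sq]
  have h2 : k + 1 + 1 = k + 2 := rfl
  rw [h2]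
  generalize z k = u0, z (k + 1) = u1, z (k + 2) = u2
  simp only [inner_add_left, inner_add_right, real_inner_smul_left, real_inner_smul_right,
    real_inner_comm u0 u1, real_inner_comm u0 u2, real_inner_comm u1 u2,
    real_inner_self_eq_norm_sq]
  have e1 : (-((1 + ε) / 2) * a₁ θ ε) ^ 2 = ((1 + ε) / 2) ^ 2 * a₁ θ ε ^ 2 := by ring
  have e2 : (-((1 - ε) / 2) * a₁ θ ε) ^ 2 = ((1 - ε) / 2) ^ 2 * a₁ θ ε ^ 2 := by ring
  have e3 : -((1 + ε) / 2) * a₁ θ ε * a₁ θ ε = -((1 + ε) / 2) * a₁ θ ε ^ 2 := by ring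
  have e4 : -((1 + ε) / 2) * a₁ θ ε * (-((1 - ε) / 2) * a₁ θ ε)
      = ((1 + ε) / 2) * ((1 - ε) / 2) * a₁ θ ε ^ 2 := by ring
  have e5 : a₁ θ ε * (-((1 - ε) / 2) * a₁ θ ε) = -((1 - ε) / 2) * a₁ θ ε ^ 2 := by ring
  rw [e1, e2, e3, e4, e5, ha, mul_div_assoc, ← hsdef]
  linear_combination
    (‖u2‖ ^ 2 / 8 - ‖u0‖ ^ 2 / 8 - inner ℝ u1 u2 / 4 + inner ℝ u0 u1 / 4) * hs

/-- Bounds on the `β`-coefficients that are uniform in the step variability. The first says that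
`β₂` never carries the whole of `C_β`; the last one expresses that `β₀` vanishes at `θ = 1`. -/
theorem exists_β_bound (θ : ℝ) (hθ0 : 0 ≤ θ) (hθ1 : θ ≤ 1) :
    ∃ B > 0, ∀ ε, -1 < ε → ε < 1 →
      β θ ε 2 ^ 2 ≤ B * (β θ ε 0 ^ 2 + β θ ε 1 ^ 2) ∧ β θ ε 2 ^ 2 ≤ B ∧ β θ ε 1 ^ 2 ≤ B ∧
        β θ ε 0 ^ 2 ≤ B * (1 - θ) := by
  rcases hθ1.eq_or_lt with rfl | h1
  · refine ⟨1, one_pos, fun ε _ _ => ?_⟩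
    simp [β]; norm_num
  · have h1' : 0 < 1 - θ := by linarith
    -- `s = (1 - θ²) / (1 + ε θ)²` is the only source of `ε`-dependence that could blow up
    set S := (1 + θ) / (1 - θ) with hS
    have hSpos : 0 < S := by positivity
    have key : ∀ ε, -1 < ε → ε < 1 → ∃ s, 0 ≤ s ∧ s ≤ S ∧
        β θ ε 0 = 1 / 4 * (1 - θ + s * (1 - ε ^ 2 * θ)) ∧ β θ ε 1 = 1 / 2 * (1 - s) ∧
        β θ ε 2 = 1 / 4 * (1 + θ + s * (1 + ε ^ 2 * θ)) := by
      intro ε he0 he1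
      have hp := one_add_variability_mul_pos hθ0 hθ1 he0
      refine ⟨(1 - θ ^ 2) / (1 + ε * θ) ^ 2, div_nonneg (by nlinarith) (by positivity), ?_,
        by simp [β]; ring, by simp [β], by simp [β]; ring⟩
      rw [hS, div_le_div_iff₀ (by positivity) h1']
      have h3 : 1 - θ ≤ 1 + ε * θ := by nlinarith
      have h4 : (1 - θ) ^ 2 ≤ (1 + ε * θ) ^ 2 := by gcongr
      nlinarith
    set c := (1 - θ) ^ 2 / 16 with hc
    have hcpos : 0 < c := by positivity
    set A := (2 + 2 * S) ^ 2 with hA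
    have hApos : 0 < A := by positivity
    refine ⟨A / c + A + A / (1 - θ), by positivity, fun ε he0 he1 => ?_⟩
    obtain ⟨s, hs0, hsS, hb0, hb1, hb2⟩ := key ε he0 he1
    have hε2 : ε ^ 2 ≤ 1 := by nlinarith
    have hεθ : ε ^ 2 * θ ≤ 1 := by nlinarith
    have hεθ0 : 0 ≤ ε ^ 2 * θ := by positivity
    have hsε : 0 ≤ s * (ε ^ 2 * θ) := by positivity
    have hsε' : s * (ε ^ 2 * θ) ≤ s := mul_le_of_le_one_right hs0 hεθ
    have hA0 : β θ ε 0 ^ 2 ≤ A := by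
      rw [hA]; apply sq_le_sq'
      · rw [hb0]; nlinarith
      · rw [hb0]; nlinarith
    have hA1 : β θ ε 1 ^ 2 ≤ A := by
      rw [hA]; apply sq_le_sq' <;> rw [hb1] <;> linarith
    have hA2 : β θ ε 2 ^ 2 ≤ A := by
      rw [hA]; apply sq_le_sq' <;> rw [hb2] <;> nlinarith
    have hc0 : c ≤ β θ ε 0 ^ 2 := by
      have : (1 - θ) / 4 ≤ β θ ε 0 := by rw [hb0]; nlinarith
      calc c = ((1 - θ) / 4) ^ 2 := by rw [hc]; ring
        _ ≤ _ := by gcongr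
    have hd : 0 < A / c := by positivity
    have hd' : 0 < A / (1 - θ) := by positivity
    refine ⟨?_, by linarith, by linarith, ?_⟩
    · calc β θ ε 2 ^ 2 ≤ A := hA2
        _ = A / c * c := by field_simp
        _ ≤ (A / c + A + A / (1 - θ)) * (β θ ε 0 ^ 2 + β θ ε 1 ^ 2) := by
          gcongr
          · linarith
          · nlinarith [sq_nonneg (β θ ε 1)]
    · calc β θ ε 0 ^ 2 ≤ A := hA0
        _ = A / (1 - θ) * (1 - θ) := by field_simp
        _ ≤ _ := by gcongr; linarith

/-- Under the step restriction, `x ‖z_{n,β}‖²` is absorbed by the energies at the levels `n + 1`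
and `n`, with a share `y < 1` of the former. The restriction is not strict, but `β₂² < C_β`
uniformly in the step variability keeps `y` away from `1`. -/
theorem exists_absorb (θ : ℝ) : ∃ C > 0, 0 ≤ θ → θ ≤ 1 → ∀ ε, -1 < ε → ε < 1 →
    ∀ x, 0 ≤ x → (∑ l : Fin 3, β θ ε l ^ 2) * x ≤ (1 + θ) / 4 →
    ∃ y z : ℝ, 0 ≤ y ∧ y < 1 ∧ 0 ≤ z ∧ 1 + z ≤ Real.exp (C * x) * (1 - y) ∧
      ∀ (E : Type) [NormedAddCommGroup E] [InnerProductSpace ℝ E] (v : ℕ → E) (n : ℕ), 1 ≤ n →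
        x * ‖comb (β θ ε) v n‖ ^ 2
          ≤ y * ((1 + θ) / 4 * ‖v (n + 1)‖ ^ 2 + (1 - θ) / 4 * ‖v n‖ ^ 2)
            + z * ((1 + θ) / 4 * ‖v n‖ ^ 2 + (1 - θ) / 4 * ‖v (n - 1)‖ ^ 2) := by
  by_cases hθ : 0 ≤ θ ∧ θ ≤ 1
  swap
  · exact ⟨1, one_pos, fun h0 h1 => absurd ⟨h0, h1⟩ hθ⟩
  obtain ⟨hθ0, hθ1⟩ := hθ
  obtain ⟨B, hB, hβ⟩ := exists_β_bound θ hθ0 hθ1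
  refine ⟨8 * (1 + 2 * B) * B + (4 * B + 2) * (2 + 2 * B), by positivity,
    fun _ _ ε he0 he1 x hx hstep => ?_⟩
  obtain ⟨hb, hb2, hb1, hb0⟩ := hβ ε he0 he1
  rw [Fin.sum_univ_three] at hstep
  generalize hβ0 : β θ ε 0 = β0 at *
  generalize hβ1 : β θ ε 1 = β1 at *
  generalize hβ2 : β θ ε 2 = β2 at *
  have h1θ : 0 < 1 + θ := by linarith
  set y := (1 + 1 / (2 * B)) * β2 ^ 2 * x * (4 / (1 + θ)) with hy
  set z := 8 * (1 + 2 * B) * B * x with hz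
  have hy0 : 0 ≤ y := by positivity
  have hz0 : 0 ≤ z := by positivity
  have hyx : y ≤ (4 * B + 2) * x := by
    calc y ≤ (1 + 1 / (2 * B)) * B * x * 4 := by
          rw [hy]; gcongr
          rw [div_le_iff₀ h1θ]; linarith
      _ = (4 * B + 2) * x := by field_simp; ring
  have hβ2x : (1 + B) * (β2 ^ 2 * x) ≤ B * ((1 + θ) / 4) := by
    nlinarith [mul_le_mul_of_nonneg_right hb hx]
  have hyη : y ≤ 1 - 1 / (2 + 2 * B) := by
    have : y = (1 + 2 * B) / (2 * B * (1 + B)) * (4 / (1 + θ)) * ((1 + B) * (β2 ^ 2 * x)) := by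
      rw [hy]; field_simp; ring
    rw [this]
    calc _ ≤ (1 + 2 * B) / (2 * B * (1 + B)) * (4 / (1 + θ)) * (B * ((1 + θ) / 4)) := by gcongr
      _ = _ := by field_simp; ring
  have hη : 0 < 1 / (2 + 2 * B) := by positivity
  have hy1 : 0 < 1 - y := by linarith
  refine ⟨y, z, hy0, by linarith, hz0, ?_, ?_⟩
  · have h1 : 1 ≤ (1 + (2 + 2 * B) * y) * (1 - y) := by
      have : 1 ≤ (2 + 2 * B) * (1 - y) := by
        have := mul_le_mul_of_nonneg_left (show 1 / (2 + 2 * B) ≤ 1 - y by linarith)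
          (show 0 ≤ 2 + 2 * B by positivity)
        rwa [mul_one_div_cancel (by positivity)] at this
      nlinarith
    have h2 : 1 + (2 + 2 * B) * y ≤ Real.exp ((4 * B + 2) * (2 + 2 * B) * x) := by
      calc 1 + (2 + 2 * B) * y ≤ (2 + 2 * B) * ((4 * B + 2) * x) + 1 := by
            have : (2 + 2 * B) * y ≤ (2 + 2 * B) * ((4 * B + 2) * x) := by gcongr
            linarith
        _ ≤ _ := Real.add_one_le_exp _
        _ = _ := by ring_nf
    have h3 : 1 + z ≤ Real.exp z := by linarith [Real.add_one_le_exp z]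
    calc 1 + z ≤ Real.exp z * 1 := by linarith
      _ ≤ Real.exp z * ((1 + (2 + 2 * B) * y) * (1 - y)) := by gcongr
      _ ≤ Real.exp z * (Real.exp ((4 * B + 2) * (2 + 2 * B) * x) * (1 - y)) := by gcongr
      _ = _ := by rw [← mul_assoc, ← Real.exp_add, hz]; ring_nf
  · intro E _ _ v n hn
    obtain ⟨k, rfl⟩ : ∃ k, n = k + 1 := ⟨n - 1, by omega⟩
    have e : k + 1 - 1 = k := by omega
    simp only [comb, Fin.sum_univ_three, e, Fin.val_zero, Fin.val_one, Fin.val_two, add_zero,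
      hβ0, hβ1, hβ2, show k + 1 + 1 = k + 2 from rfl]
    generalize v k = u0, v (k + 1) = u1, v (k + 2) = u2
    -- Young's inequality with weights `1 + 1 / (2B)` and `1 + 2B`
    have tri : ‖β0 • u0 + β1 • u1 + β2 • u2‖ ≤ |β0| * ‖u0‖ + |β1| * ‖u1‖ + |β2| * ‖u2‖ := by
      refine norm_add₃_le.trans (le_of_eq ?_)
      simp [norm_smul]
    have young : ‖β0 • u0 + β1 • u1 + β2 • u2‖ ^ 2
        ≤ (1 + 1 / (2 * B)) * (β2 ^ 2 * ‖u2‖ ^ 2)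
          + (1 + 2 * B) * (2 * (β1 ^ 2 * ‖u1‖ ^ 2) + 2 * (β0 ^ 2 * ‖u0‖ ^ 2)) := by
      rw [← sq_abs β0, ← sq_abs β1, ← sq_abs β2, ← mul_pow, ← mul_pow, ← mul_pow]
      refine (pow_le_pow_left₀ (norm_nonneg _) tri 2).trans ?_
      generalize |β0| * ‖u0‖ = p, |β1| * ‖u1‖ = q, |β2| * ‖u2‖ = s
      have hw : (p + q + s) ^ 2 + 1 / (2 * B) * (s - 2 * B * (p + q)) ^ 2
          + (1 + 2 * B) * (p - q) ^ 2
          = (1 + 1 / (2 * B)) * s ^ 2 + (1 + 2 * B) * (2 * q ^ 2 + 2 * p ^ 2) := by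
        field_simp
        ring
      have : 0 ≤ 1 / (2 * B) * (s - 2 * B * (p + q)) ^ 2 := by positivity
      have : 0 ≤ (1 + 2 * B) * (p - q) ^ 2 := by positivity
      linarith
    have t2 : x * ((1 + 1 / (2 * B)) * (β2 ^ 2 * ‖u2‖ ^ 2)) = y * ((1 + θ) / 4 * ‖u2‖ ^ 2) := by
      rw [hy]; field_simp
    have t1 : x * ((1 + 2 * B) * (2 * (β1 ^ 2 * ‖u1‖ ^ 2)))
        ≤ z * ((1 + θ) / 4 * ‖u1‖ ^ 2) := by
      calc _ ≤ x * ((1 + 2 * B) * (2 * (B * ‖u1‖ ^ 2))) := by gcongr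
        _ = z * (1 / 4 * ‖u1‖ ^ 2) := by rw [hz]; ring
        _ ≤ _ := by gcongr; linarith
    have t0 : x * ((1 + 2 * B) * (2 * (β0 ^ 2 * ‖u0‖ ^ 2)))
        ≤ z * ((1 - θ) / 4 * ‖u0‖ ^ 2) := by
      calc _ ≤ x * ((1 + 2 * B) * (2 * (B * (1 - θ) * ‖u0‖ ^ 2))) := by gcongr
        _ = z * ((1 - θ) / 4 * ‖u0‖ ^ 2) := by rw [hz]; ring
    have t3 : 0 ≤ y * ((1 - θ) / 4 * ‖u1‖ ^ 2) := by
      have : 0 ≤ 1 - θ := by linarith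
      positivity
    have := mul_le_mul_of_nonneg_left young hx
    linarith

/-! ### Weak gradients -/

variable {D : Set Plane}

theorem isFiniteMeasure_restrict (hb : Bornology.IsBounded D) :
    IsFiniteMeasure (volume.restrict D) :=
  ⟨by rw [Measure.restrict_apply_univ]; exact hb.measure_lt_top⟩

theorem IsTestFunction.add {F : Type*} [NormedAddCommGroup F] [NormedSpace ℝ F]
    {φ ψ : Plane → F} (hφ : IsTestFunction D φ) (hψ : IsTestFunction D ψ) :
    IsTestFunction D (φ + ψ) :=
  ⟨hφ.1.add hψ.1, hφ.2.1.add hψ.2.1, (tsupport_add φ ψ).trans (Set.union_subset hφ.2.2 hψ.2.2)⟩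

theorem IsTestFunction.const_smul {F : Type*} [NormedAddCommGroup F] [NormedSpace ℝ F]
    {φ : Plane → F} (hφ : IsTestFunction D φ) (c : ℝ) : IsTestFunction D (c • φ) :=
  ⟨hφ.1.const_smul c, hφ.2.1.smul_left (f := fun _ => c),
    (tsupport_smul_subset_right (fun _ => c) φ).trans hφ.2.2⟩

theorem integrableOn_mul_of_tsupport_subset {g ψ : Plane → ℝ}
    (hg : LocallyIntegrableOn g D) (hψ : Continuous ψ) (hc : HasCompactSupport ψ)
    (hs : tsupport ψ ⊆ D) : IntegrableOn (fun x => g x * ψ x) D := by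
  obtain ⟨C, hC⟩ := hψ.bounded_above_of_compact_support hc
  have h1 : IntegrableOn g (tsupport ψ) := hg.integrableOn_compact_subset hs hc
  have h2 : IntegrableOn (fun x => g x * ψ x) (tsupport ψ) :=
    Integrable.mul_bdd h1 hψ.aestronglyMeasurable (Filter.Eventually.of_forall hC)
  have h3 : Function.support (fun x => g x * ψ x) ⊆ tsupport ψ := by
    refine fun x hx => subset_tsupport ψ ?_
    rw [Function.mem_support] at hx ⊢
    exact right_ne_zero_of_mul hx
  exact ((integrableOn_iff_integrable_of_support_subset h3).1 h2).integrableOn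

theorem LocallyIntegrableOn.clm_comp {E F : Type*} [NormedAddCommGroup E] [NormedSpace ℝ E]
    [NormedAddCommGroup F] [NormedSpace ℝ F] {v : Plane → E} (L : E →L[ℝ] F)
    (hv : LocallyIntegrableOn v D) : LocallyIntegrableOn (fun x => L (v x)) D := fun x hx =>
  let ⟨s, hs, hi⟩ := hv x hx
  ⟨s, hs, L.integrable_comp hi⟩

theorem locallyIntegrableOn_apply {ι : Type*} [Fintype ι] {v : Plane → EuclideanSpace ℝ ι}
    (hv : LocallyIntegrableOn v D) (i : ι) : LocallyIntegrableOn (fun x => v x i) D :=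
  LocallyIntegrableOn.clm_comp (EuclideanSpace.proj i) hv

/-- Weak gradients are unique almost everywhere. -/
theorem HasWeakGrad.ae_eq (hD : IsOpen D) {v : Plane → Plane} {G G' : Plane → Grad}
    (h : HasWeakGrad D v G) (h' : HasWeakGrad D v G') : G =ᵐ[volume.restrict D] G' := by
  have key : ∀ ij : Fin 2 × Fin 2, ∀ᵐ x ∂volume.restrict D, G x ij = G' x ij := by
    rintro ⟨i, j⟩
    have hG := locallyIntegrableOn_apply h.2.1 (i, j)
    have hG' := locallyIntegrableOn_apply h'.2.1 (i, j)
    have := hD.ae_eq_zero_of_integral_contDiff_smul_eq_zero (hG.sub hG') ?_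
    · rw [ae_restrict_iff' hD.measurableSet]
      filter_upwards [this] with x hx hxD
      exact sub_eq_zero.1 (hx hxD)
    · intro φ hφ hc hs
      rw [← setIntegral_eq_integral_of_forall_compl_eq_zero (s := D)]
      · have e : ∀ x, φ x • ((fun x => G x (i, j)) - fun x => G' x (i, j)) x
            = G x (i, j) * φ x - G' x (i, j) * φ x := by
          intro x; simp only [Pi.sub_apply, smul_eq_mul]; ring
        simp_rw [e]
        rw [integral_sub (integrableOn_mul_of_tsupport_subset hG hφ.continuous hc hs)
          (integrableOn_mul_of_tsupport_subset hG' hφ.continuous hc hs)]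
        have e1 := h.2.2 φ ⟨hφ, hc, hs⟩ i j
        have e2 := h'.2.2 φ ⟨hφ, hc, hs⟩ i j
        linarith
      · intro x hx
        rw [image_eq_zero_of_notMem_tsupport fun hx' => hx (hs hx'), zero_smul]
  filter_upwards [ae_all_iff.2 key] with x hx
  ext ij
  exact hx ij

theorem IsTestFunction.integrableOn_mul_fderiv {φ : Plane → ℝ}
    (hφ : IsTestFunction D φ) {g : Plane → ℝ} (hg : LocallyIntegrableOn g D) (e : Plane) :
    IntegrableOn (fun x => g x * fderiv ℝ φ x e) D := by
  refine integrableOn_mul_of_tsupport_subset hg ?_ (hφ.2.1.fderiv_apply ℝ e)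
    ((tsupport_fderiv_apply_subset ℝ e).trans hφ.2.2)
  exact (hφ.1.continuous_fderiv (by simp)).clm_apply continuous_const

theorem HasWeakGrad.add {v w : Plane → Plane} {G H : Plane → Grad}
    (hv : HasWeakGrad D v G) (hw : HasWeakGrad D w H) : HasWeakGrad D (v + w) (G + H) := by
  refine ⟨hv.1.add hw.1, hv.2.1.add hw.2.1, fun φ hφ i j => ?_⟩
  simp only [Pi.add_apply, PiLp.add_apply, add_mul]
  rw [integral_add (hφ.integrableOn_mul_fderiv (locallyIntegrableOn_apply hv.1 i) _)
      (hφ.integrableOn_mul_fderiv (locallyIntegrableOn_apply hw.1 i) _),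
    integral_add
      (integrableOn_mul_of_tsupport_subset (locallyIntegrableOn_apply hv.2.1 (i, j))
        hφ.1.continuous hφ.2.1 hφ.2.2)
      (integrableOn_mul_of_tsupport_subset (locallyIntegrableOn_apply hw.2.1 (i, j))
        hφ.1.continuous hφ.2.1 hφ.2.2), hv.2.2 φ hφ i j, hw.2.2 φ hφ i j]
  ring

theorem HasWeakGrad.const_smul {v : Plane → Plane} {G : Plane → Grad}
    (hv : HasWeakGrad D v G) (c : ℝ) : HasWeakGrad D (c • v) (c • G) := by
  refine ⟨hv.1.smul c, hv.2.1.smul c, fun φ hφ i j => ?_⟩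
  simp only [Pi.smul_apply, PiLp.smul_apply, smul_eq_mul, mul_assoc]
  rw [integral_const_mul, integral_const_mul, hv.2.2 φ hφ i j]
  ring

theorem hasWeakGrad_grad {v : Plane → Plane} (h : ∃ G, HasWeakGrad D v G) :
    HasWeakGrad D v (grad D v) := by
  rw [grad, dif_pos h]
  exact h.choose_spec

theorem MemH1.hasWeakGrad {v : Plane → Plane} (h : MemH1 D v) : HasWeakGrad D v (grad D v) :=
  hasWeakGrad_grad h.2.1

theorem grad_add_ae (hD : IsOpen D) {v w : Plane → Plane} (hv : MemH1 D v) (hw : MemH1 D w) :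
    grad D (v + w) =ᵐ[volume.restrict D] grad D v + grad D w :=
  have h := hv.hasWeakGrad.add hw.hasWeakGrad
  (hasWeakGrad_grad ⟨_, h⟩).ae_eq hD h

theorem grad_const_smul_ae (hD : IsOpen D) {v : Plane → Plane} (hv : MemH1 D v) (c : ℝ) :
    grad D (c • v) =ᵐ[volume.restrict D] c • grad D v :=
  have h := hv.hasWeakGrad.const_smul c
  (hasWeakGrad_grad ⟨_, h⟩).ae_eq hD h

theorem MemH1.add (hD : IsOpen D) {v w : Plane → Plane} (hv : MemH1 D v) (hw : MemH1 D w) :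
    MemH1 D (v + w) :=
  ⟨hv.1.add hw.1, ⟨_, hv.hasWeakGrad.add hw.hasWeakGrad⟩,
    (memLp_congr_ae (grad_add_ae hD hv hw)).2 (hv.2.2.add hw.2.2)⟩

theorem MemH1.const_smul (hD : IsOpen D) {v : Plane → Plane} (hv : MemH1 D v) (c : ℝ) :
    MemH1 D (c • v) :=
  ⟨hv.1.const_smul c, ⟨_, hv.hasWeakGrad.const_smul c⟩,
    (memLp_congr_ae (grad_const_smul_ae hD hv c)).2 (hv.2.2.const_smul c)⟩

theorem div_add_ae (hD : IsOpen D) {v w : Plane → Plane} (hv : MemH1 D v) (hw : MemH1 D w) :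
    div D (v + w) =ᵐ[volume.restrict D] div D v + div D w := by
  filter_upwards [grad_add_ae hD hv hw] with x hx
  simp [div, hx, Finset.sum_add_distrib]

theorem div_const_smul_ae (hD : IsOpen D) {v : Plane → Plane} (hv : MemH1 D v) (c : ℝ) :
    div D (c • v) =ᵐ[volume.restrict D] c • div D v := by
  filter_upwards [grad_const_smul_ae hD hv c] with x hx
  simp [div, hx]
  ring

theorem MemH1.memLp_div {v : Plane → Plane} (hv : MemH1 D v) :
    MemLp (div D v) 2 (volume.restrict D) := by
  refine memLp_finsetSum _ fun i _ => ?_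
  exact (EuclideanSpace.proj (i, i) : Grad →L[ℝ] ℝ).comp_memLp' hv.2.2

/-! ### The space `X` and the Poincaré inequality -/

theorem continuous_classicalGrad {φ : Plane → Plane} (hφ : ContDiff ℝ ∞ φ) :
    Continuous (classicalGrad φ) := by
  refine (PiLp.continuous_toLp 2 _).comp (continuous_pi fun ij => ?_)
  have h : Continuous fun x => fderiv ℝ φ x (EuclideanSpace.single ij.2 1) :=
    (hφ.continuous_fderiv (by simp)).clm_apply continuous_const
  exact (EuclideanSpace.proj ij.1 : Plane →L[ℝ] ℝ).continuous.comp h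

theorem classicalGrad_add {φ ψ : Plane → Plane} (hφ : ContDiff ℝ ∞ φ) (hψ : ContDiff ℝ ∞ ψ) :
    classicalGrad (φ + ψ) = classicalGrad φ + classicalGrad ψ := by
  ext x ij
  simp [classicalGrad, fderiv_add (hφ.differentiable (by simp) x) (hψ.differentiable (by simp) x)]

theorem classicalGrad_const_smul {φ : Plane → Plane} (hφ : ContDiff ℝ ∞ φ) (c : ℝ) :
    classicalGrad (c • φ) = c • classicalGrad φ := by
  ext x ij
  simp [classicalGrad, fderiv_const_smul (hφ.differentiable (by simp) x)]

theorem MemX.add (hD : IsOpen D) {v w : Plane → Plane} (hv : MemX D v) (hw : MemX D w) :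
    MemX D (v + w) := by
  refine ⟨hv.1.add hD hw.1, fun ε hε => ?_⟩
  obtain ⟨φ, hφ, h1, h2⟩ := hv.2 (ε / 2) (half_pos hε)
  obtain ⟨ψ, hψ, h3, h4⟩ := hw.2 (ε / 2) (half_pos hε)
  have e : ENNReal.ofReal ε = ENNReal.ofReal (ε / 2) + ENNReal.ofReal (ε / 2) := by
    rw [← ENNReal.ofReal_add (half_pos hε).le (half_pos hε).le, add_halves]
  refine ⟨φ + ψ, hφ.add hψ, ?_, ?_⟩
  · rw [add_sub_add_comm, e]
    refine (eLpNorm_add_le ?_ ?_ one_le_two).trans_lt (ENNReal.add_lt_add h1 h3)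
    · exact hv.1.1.1.sub hφ.1.continuous.aestronglyMeasurable
    · exact hw.1.1.1.sub hψ.1.continuous.aestronglyMeasurable
  · rw [classicalGrad_add hφ.1 hψ.1,
      eLpNorm_congr_ae ((grad_add_ae hD hv.1 hw.1).sub (Filter.EventuallyEq.refl _ _)),
      add_sub_add_comm, e]
    refine (eLpNorm_add_le ?_ ?_ one_le_two).trans_lt (ENNReal.add_lt_add h2 h4)
    · exact hv.1.2.2.1.sub (continuous_classicalGrad hφ.1).aestronglyMeasurable
    · exact hw.1.2.2.1.sub (continuous_classicalGrad hψ.1).aestronglyMeasurable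

theorem MemX.const_smul (hD : IsOpen D) {v : Plane → Plane} (hv : MemX D v) (c : ℝ) :
    MemX D (c • v) := by
  refine ⟨hv.1.const_smul hD c, fun ε hε => ?_⟩
  have hc : 0 < |c| + 1 := by positivity
  obtain ⟨φ, hφ, h1, h2⟩ := hv.2 (ε / (|c| + 1)) (by positivity)
  have key : ∀ a : ENNReal, a < ENNReal.ofReal (ε / (|c| + 1)) →
      ‖c‖ₑ * a < ENNReal.ofReal ε := by
    intro a ha
    have hle : ‖c‖ₑ ≤ ENNReal.ofReal (|c| + 1) := by
      rw [← ofReal_norm, Real.norm_eq_abs]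
      exact ENNReal.ofReal_le_ofReal (by linarith)
    calc ‖c‖ₑ * a ≤ ENNReal.ofReal (|c| + 1) * a := by gcongr
      _ < ENNReal.ofReal (|c| + 1) * ENNReal.ofReal (ε / (|c| + 1)) :=
        ENNReal.mul_lt_mul_right (by simpa using hc) ENNReal.ofReal_ne_top ha
      _ = ENNReal.ofReal ε := by
        rw [← ENNReal.ofReal_mul hc.le, mul_div_cancel₀ _ hc.ne']
  refine ⟨c • φ, hφ.const_smul c, ?_, ?_⟩
  · rw [← smul_sub, eLpNorm_const_smul]
    exact key _ h1
  · rw [classicalGrad_const_smul hφ.1,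
      eLpNorm_congr_ae ((grad_const_smul_ae hD hv.1 c).sub (Filter.EventuallyEq.refl _ _)),
      ← smul_sub, eLpNorm_const_smul]
    exact key _ h2

theorem norm_fderiv_le_norm_classicalGrad (φ : Plane → Plane) (x : Plane) :
    ‖fderiv ℝ φ x‖ ≤ ‖classicalGrad φ x‖ := by
  refine ContinuousLinearMap.opNorm_le_bound _ (norm_nonneg _) fun y => ?_
  have hy : fderiv ℝ φ x y = ∑ j : Fin 2, y j • fderiv ℝ φ x (EuclideanSpace.single j 1) := by
    conv_lhs => rw [← (EuclideanSpace.basisFun (Fin 2) ℝ).sum_repr y]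
    simp
  refine le_of_sq_le_sq ?_ (by positivity)
  rw [mul_pow, EuclideanSpace.norm_sq_eq, EuclideanSpace.norm_sq_eq, EuclideanSpace.norm_sq_eq y,
    hy, Fintype.sum_prod_type]
  simp only [Fin.sum_univ_two, classicalGrad, Real.norm_eq_abs, sq_abs, PiLp.add_apply,
    PiLp.smul_apply, smul_eq_mul]
  generalize fderiv ℝ φ x (EuclideanSpace.single 0 1) = p,
    fderiv ℝ φ x (EuclideanSpace.single 1 1) = q
  nlinarith [sq_nonneg (y 0 * q 0 - y 1 * p 0), sq_nonneg (y 0 * q 1 - y 1 * p 1)]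

/-- The Poincaré inequality for test fields, from the planar Sobolev inequality
`‖φ‖_{L²} ≤ C ‖∇φ‖_{L¹}` and Hölder's inequality on the bounded set `D`. -/
theorem exists_eLpNorm_le_of_isTestFunction (hb : Bornology.IsBounded D) :
    ∃ K : NNReal, ∀ φ : Plane → Plane, IsTestFunction D φ →
      eLpNorm φ 2 (volume.restrict D) ≤ K * eLpNorm (classicalGrad φ) 2 (volume.restrict D) := by
  have hconj : NNReal.HolderConjugate (Module.finrank ℝ Plane : NNReal) 2 := by
    rw [finrank_euclideanSpace_fin]
    exact_mod_cast NNReal.HolderConjugate.two_two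
  set K₁ := eLpNormLESNormFDerivOneConst (volume : Measure Plane) ((2 : NNReal) : ℝ)
  have hfin := isFiniteMeasure_restrict hb
  have hm : (volume.restrict D Set.univ) ^ (1 / (1 : ENNReal).toReal - 1 / (2 : ENNReal).toReal)
      ≠ ⊤ := ENNReal.rpow_ne_top_of_nonneg (by norm_num) (measure_ne_top _ _)
  obtain ⟨m, hm'⟩ : ∃ m : NNReal, (m : ENNReal) = _ := ⟨_, ENNReal.coe_toNNReal hm⟩
  refine ⟨K₁ * m, fun φ hφ => ?_⟩
  have hs : Function.support (classicalGrad φ) ⊆ D := by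
    refine fun x hx => hφ.2.2 (tsupport_fderiv_subset ℝ (subset_tsupport _ fun h => hx ?_))
    ext ij
    simp [classicalGrad, h]
  calc eLpNorm φ 2 (volume.restrict D) ≤ eLpNorm φ 2 volume := eLpNorm_restrict_le _ _ _ _
    _ ≤ K₁ * eLpNorm (fderiv ℝ φ) 1 volume :=
      eLpNorm_le_eLpNorm_fderiv_one volume (hφ.1.of_le (by simp)) hφ.2.1 hconj
    _ ≤ K₁ * eLpNorm (classicalGrad φ) 1 volume := by
      gcongr
      exact eLpNorm_mono (norm_fderiv_le_norm_classicalGrad φ)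
    _ = K₁ * eLpNorm (classicalGrad φ) 1 (volume.restrict D) := by
      rw [eLpNorm_restrict_eq_of_support_subset hs]
    _ ≤ K₁ * (eLpNorm (classicalGrad φ) 2 (volume.restrict D) * m) := by
      rw [hm']
      gcongr
      exact eLpNorm_le_eLpNorm_mul_rpow_measure_univ one_le_two
        (continuous_classicalGrad hφ.1).aestronglyMeasurable
    _ = _ := by push_cast; ring

/-- The Poincaré inequality on `X`, by density of the test fields. -/
theorem exists_eLpNorm_le_grad (hb : Bornology.IsBounded D) :
    ∃ K : NNReal, ∀ v : Plane → Plane, MemX D v →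
      eLpNorm v 2 (volume.restrict D) ≤ K * eLpNorm (grad D v) 2 (volume.restrict D) := by
  obtain ⟨K, hK⟩ := exists_eLpNorm_le_of_isTestFunction hb
  refine ⟨K, fun v hv => ?_⟩
  refine ENNReal.le_of_forall_pos_le_add fun ε hε _ => ?_
  set δ : NNReal := ε / (1 + K) with hδ
  have hδ0 : 0 < δ := by positivity
  obtain ⟨φ, hφ, h1, h2⟩ := hv.2 δ hδ0
  rw [ENNReal.ofReal_coe_nnreal] at h1 h2
  have hφm := hφ.1.continuous.aestronglyMeasurable (μ := volume.restrict D)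
  have hgm := (continuous_classicalGrad hφ.1).aestronglyMeasurable (μ := volume.restrict D)
  have hg : eLpNorm (classicalGrad φ) 2 (volume.restrict D)
      ≤ δ + eLpNorm (grad D v) 2 (volume.restrict D) := by
    calc _ = eLpNorm ((classicalGrad φ - grad D v) + grad D v) 2 (volume.restrict D) := by
          rw [sub_add_cancel]
      _ ≤ _ := eLpNorm_add_le (hgm.sub hv.1.2.2.1) hv.1.2.2.1 one_le_two
      _ ≤ _ := by
        rw [eLpNorm_sub_comm]
        gcongr
  calc eLpNorm v 2 (volume.restrict D) = eLpNorm ((v - φ) + φ) 2 (volume.restrict D) := by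
        rw [sub_add_cancel]
    _ ≤ _ := eLpNorm_add_le (hv.1.1.1.sub hφm) hφm one_le_two
    _ ≤ δ + K * (δ + eLpNorm (grad D v) 2 (volume.restrict D)) := by
      gcongr
      exact (hK φ hφ).trans (by gcongr)
    _ = K * eLpNorm (grad D v) 2 (volume.restrict D) + ((1 + K) * δ : NNReal) := by
      push_cast; ring
    _ = _ := by rw [hδ, mul_div_cancel₀ _ (by positivity)]

/-! ### The `L²` inner product -/

section L2

variable {F : Type*} [NormedAddCommGroup F] [InnerProductSpace ℝ F]

theorem integrable_inner_of_memLp {u v : Plane → F} (hu : MemLp u 2 (volume.restrict D))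
    (hv : MemLp v 2 (volume.restrict D)) :
    Integrable (fun x => inner ℝ (u x) (v x)) (volume.restrict D) := by
  refine (L2.integrable_inner (𝕜 := ℝ) (hu.toLp u) (hv.toLp v)).congr ?_
  filter_upwards [hu.coeFn_toLp, hv.coeFn_toLp] with x h1 h2
  rw [h1, h2]

theorem inner_toLp_eq_ip {u v : Plane → F} (hu : MemLp u 2 (volume.restrict D))
    (hv : MemLp v 2 (volume.restrict D)) :
    inner ℝ (hu.toLp u) (hv.toLp v) = ip D u v := by
  rw [L2.inner_def]
  refine integral_congr_ae ?_
  filter_upwards [hu.coeFn_toLp, hv.coeFn_toLp] with x h1 h2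
  rw [h1, h2]

theorem ip_self (u : Plane → F) : ip D u u = normSq D u := by
  simp [ip, normSq]

theorem ip_add_left {u v w : Plane → F} (hu : MemLp u 2 (volume.restrict D))
    (hv : MemLp v 2 (volume.restrict D)) (hw : MemLp w 2 (volume.restrict D)) :
    ip D (u + v) w = ip D u w + ip D v w := by
  simp only [ip, Pi.add_apply, inner_add_left]
  exact integral_add (integrable_inner_of_memLp hu hw) (integrable_inner_of_memLp hv hw)

theorem ip_const_smul_left (c : ℝ) (u w : Plane → F) : ip D (c • u) w = c * ip D u w := by
  simp only [ip, Pi.smul_apply, real_inner_smul_left]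
  exact integral_const_mul _ _

theorem ip_comm (u w : Plane → F) : ip D u w = ip D w u := by
  simp only [ip, real_inner_comm]

theorem ip_congr_left {u v : Plane → F} (h : u =ᵐ[volume.restrict D] v) (w : Plane → F) :
    ip D u w = ip D v w :=
  integral_congr_ae (by filter_upwards [h] with x hx; rw [hx])

theorem norm_toLp_sq {u : Plane → F} (hu : MemLp u 2 (volume.restrict D)) :
    ‖hu.toLp u‖ ^ 2 = normSq D u := by
  rw [← real_inner_self_eq_norm_sq, inner_toLp_eq_ip, ip_self]

theorem normSq_nonneg (D : Set Plane) (u : Plane → F) : 0 ≤ normSq D u :=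
  integral_nonneg fun _ => by positivity

end L2

/-- The Poincaré inequality on `X`, for the squared norms. -/
theorem exists_normSq_le_grad (hb : Bornology.IsBounded D) :
    ∃ C > 0, ∀ v : Plane → Plane, MemX D v → normSq D v ≤ C * normSq D (grad D v) := by
  obtain ⟨K, hK⟩ := exists_eLpNorm_le_grad hb
  refine ⟨(K + 1) ^ 2, by positivity, fun v hv => ?_⟩
  rw [← norm_toLp_sq hv.1.1, ← norm_toLp_sq hv.1.2.2, Lp.norm_toLp, Lp.norm_toLp, ← mul_pow]
  gcongr
  calc _ ≤ (K * eLpNorm (grad D v) 2 (volume.restrict D)).toReal :=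
        ENNReal.toReal_mono (ENNReal.mul_ne_top ENNReal.coe_ne_top hv.1.2.2.2.ne) (hK v hv)
    _ = K * (eLpNorm (grad D v) 2 (volume.restrict D)).toReal := by simp
    _ ≤ _ := by gcongr; simp

/-! ### Fields as elements of the Hilbert space `L²(D)` -/

open Classical in
/-- The class in `L²(D)` of a square integrable field, and `0` for any other field. -/
noncomputable def toL2 {F : Type*} [NormedAddCommGroup F] (D : Set Plane) (u : Plane → F) :
    Lp F 2 (volume.restrict D) :=
  if h : MemLp u 2 (volume.restrict D) then h.toLp u else 0

section toL2

variable {F : Type*} [NormedAddCommGroup F] [InnerProductSpace ℝ F]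

theorem memLp_comb {u : ℕ → Plane → F} {n : ℕ}
    (h : ∀ l : Fin 3, MemLp (u (n - 1 + l)) 2 (volume.restrict D)) (c : Fin 3 → ℝ) :
    MemLp (comb c u n) 2 (volume.restrict D) := by
  have hs : ∀ l : Fin 3, MemLp (c l • u (n - 1 + l)) 2 (volume.restrict D) :=
    fun l => (h l).const_smul (c l)
  rw [comb, Fin.sum_univ_three]
  exact ((hs 0).add (hs 1)).add (hs 2)

theorem toL2_comb {c : Fin 3 → ℝ} {u : ℕ → Plane → F} {n : ℕ}
    (h : ∀ l : Fin 3, MemLp (u (n - 1 + l)) 2 (volume.restrict D)) :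
    toL2 D (comb c u n) = comb c (fun k => toL2 D (u k)) n := by
  have hs : ∀ l : Fin 3, MemLp (c l • u (n - 1 + l)) 2 (volume.restrict D) :=
    fun l => (h l).const_smul (c l)
  have e : ∀ l : Fin 3, toL2 D (u (n - 1 + l)) = (h l).toLp _ := fun l => dif_pos (h l)
  simp only [comb, Fin.sum_univ_three, e]
  rw [toL2, dif_pos (((hs 0).add (hs 1)).add (hs 2))]
  rfl

theorem inner_toL2 {u v : Plane → F} (hu : MemLp u 2 (volume.restrict D))
    (hv : MemLp v 2 (volume.restrict D)) : inner ℝ (toL2 D u) (toL2 D v) = ip D u v := by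
  rw [toL2, dif_pos hu, toL2, dif_pos hv, inner_toLp_eq_ip]

theorem norm_toL2_sq {u : Plane → F} (hu : MemLp u 2 (volume.restrict D)) :
    ‖toL2 D u‖ ^ 2 = normSq D u := by
  rw [toL2, dif_pos hu, norm_toLp_sq]

/-- The Cauchy–Schwarz inequality in `L²(D)`, with the first argument given as a class. -/
theorem ip_coeFn_le (f : Lp F 2 (volume.restrict D)) {v : Plane → F}
    (hv : MemLp v 2 (volume.restrict D)) : ip D f v ≤ ‖f‖ * √(normSq D v) := by
  have h : ip D f v = inner ℝ f (hv.toLp v) := by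
    rw [L2.inner_def]
    refine integral_congr_ae ?_
    filter_upwards [hv.coeFn_toLp] with x hx
    rw [hx]
  rw [h, ← norm_toLp_sq hv, Real.sqrt_sq (norm_nonneg _)]
  exact real_inner_le_norm _ _

end toL2

/-! ### Finite element spaces -/

theorem comb_induction {F : Type*} [AddCommGroup F] [Module ℝ F] {p : F → Prop}
    (add : ∀ x y, p x → p y → p (x + y)) (smul : ∀ (c : ℝ) x, p x → p (c • x))
    {c : Fin 3 → ℝ} {z : ℕ → F} {n : ℕ} (h : ∀ l : Fin 3, p (z (n - 1 + l))) :
    p (comb c z n) := by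
  rw [comb, Fin.sum_univ_three]
  exact add _ _ (add _ _ (smul _ _ (h 0)) (smul _ _ (h 1))) (smul _ _ (h 2))

theorem IsPolyOn.add {k : ℕ} {K : Set Plane} {p q : Plane → ℝ} (hp : IsPolyOn k K p)
    (hq : IsPolyOn k K q) : IsPolyOn k K (fun x => p x + q x) := by
  obtain ⟨P, hP, hP'⟩ := hp
  obtain ⟨Q, hQ, hQ'⟩ := hq
  refine ⟨P + Q, (MvPolynomial.totalDegree_add P Q).trans (max_le hP hQ), fun x hx => ?_⟩
  rw [map_add, ← hP' x hx, ← hQ' x hx]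

theorem IsPolyOn.const_mul {k : ℕ} {K : Set Plane} {p : Plane → ℝ} (hp : IsPolyOn k K p)
    (c : ℝ) : IsPolyOn k K (fun x => c * p x) := by
  obtain ⟨P, hP, hP'⟩ := hp
  refine ⟨c • P, (MvPolynomial.totalDegree_smul_le c P).trans hP, fun x hx => ?_⟩
  rw [MvPolynomial.smul_eval, ← hP' x hx]

variable {𝒯 : Geometry.SimplicialComplex ℝ Plane} {r : ℕ}

theorem MemXh.add (hD : IsOpen D) {v w : Plane → Plane} (hv : MemXh D 𝒯 r v)
    (hw : MemXh D 𝒯 r w) : MemXh D 𝒯 r (v + w) :=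
  ⟨hv.1.add hw.1, hv.2.1.add hD hw.2.1, fun s hs i => (hv.2.2 s hs i).add (hw.2.2 s hs i)⟩

theorem MemXh.const_smul (hD : IsOpen D) {v : Plane → Plane} (hv : MemXh D 𝒯 r v) (c : ℝ) :
    MemXh D 𝒯 r (c • v) :=
  ⟨hv.1.const_smul c, hv.2.1.const_smul hD c, fun s hs i => (hv.2.2 s hs i).const_mul c⟩

theorem MemXh.memLp {v : Plane → Plane} (hv : MemXh D 𝒯 r v) : MemLp v 2 (volume.restrict D) :=
  hv.2.1.1.1

theorem MemXh.memLp_grad {v : Plane → Plane} (hv : MemXh D 𝒯 r v) :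
    MemLp (grad D v) 2 (volume.restrict D) :=
  hv.2.1.1.2.2

theorem MemQh.add {p q : Plane → ℝ} (hp : MemQh D 𝒯 r p) (hq : MemQh D 𝒯 r q) :
    MemQh D 𝒯 r (p + q) :=
  ⟨hp.1.add hq.1, hp.2.1.add hq.2.1, fun s hs => (hp.2.2 s hs).add (hq.2.2 s hs)⟩

theorem MemQh.const_smul {p : Plane → ℝ} (hp : MemQh D 𝒯 r p) (c : ℝ) : MemQh D 𝒯 r (c • p) :=
  ⟨hp.1.const_smul c, hp.2.1.const_smul c, fun s hs => (hp.2.2 s hs).const_mul c⟩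

theorem MemVh.add (hD : IsOpen D) {v w : Plane → Plane} (hv : MemVh D 𝒯 r v)
    (hw : MemVh D 𝒯 r w) : MemVh D 𝒯 r (v + w) := by
  refine ⟨hv.1.add hD hw.1, fun q hq => ?_⟩
  rw [ip_congr_left (div_add_ae hD hv.1.2.1.1 hw.1.2.1.1),
    ip_add_left hv.1.2.1.1.memLp_div hw.1.2.1.1.memLp_div hq.2.1, hv.2 q hq, hw.2 q hq, add_zero]

theorem MemVh.const_smul (hD : IsOpen D) {v : Plane → Plane} (hv : MemVh D 𝒯 r v) (c : ℝ) :
    MemVh D 𝒯 r (c • v) := by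
  refine ⟨hv.1.const_smul hD c, fun q hq => ?_⟩
  rw [ip_congr_left (div_const_smul_ae hD hv.1.2.1.1 c), ip_const_smul_left, hv.2 q hq, mul_zero]

/-- The velocity `u` and the auxiliary field `w` both lie in `V_h` and satisfy the auxiliary
equation. These pairs form a linear space. -/
structure IsAuxPair (D : Set Plane) (𝒯 : Geometry.SimplicialComplex ℝ Plane) (r : ℕ)
    (uw : (Plane → Plane) × (Plane → Plane)) : Prop where
  mem_u : MemVh D 𝒯 r uw.1
  mem_w : MemVh D 𝒯 r uw.2
  aux : AuxEq D 𝒯 r uw.1 uw.2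

theorem IsAuxPair.add (hD : IsOpen D) {x y : (Plane → Plane) × (Plane → Plane)}
    (hx : IsAuxPair D 𝒯 r x) (hy : IsAuxPair D 𝒯 r y) : IsAuxPair D 𝒯 r (x + y) := by
  refine ⟨hx.mem_u.add hD hy.mem_u, hx.mem_w.add hD hy.mem_w, fun φ hφ => ?_⟩
  rw [Prod.fst_add, Prod.snd_add,
    ip_congr_left (grad_add_ae hD hx.mem_u.1.2.1.1 hy.mem_u.1.2.1.1),
    ip_add_left hx.mem_w.1.memLp hy.mem_w.1.memLp hφ.1.memLp,
    ip_add_left hx.mem_u.1.memLp_grad hy.mem_u.1.memLp_grad hφ.1.memLp_grad,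
    hx.aux φ hφ, hy.aux φ hφ]

theorem IsAuxPair.const_smul (hD : IsOpen D) {x : (Plane → Plane) × (Plane → Plane)}
    (hx : IsAuxPair D 𝒯 r x) (c : ℝ) : IsAuxPair D 𝒯 r (c • x) := by
  refine ⟨hx.mem_u.const_smul hD c, hx.mem_w.const_smul hD c, fun φ hφ => ?_⟩
  rw [Prod.smul_fst, Prod.smul_snd, ip_congr_left (grad_const_smul_ae hD hx.mem_u.1.2.1.1 c),
    ip_const_smul_left, ip_const_smul_left, hx.aux φ hφ]

theorem isAuxPair_comb (hD : IsOpen D) {u w : ℕ → Plane → Plane} {c : Fin 3 → ℝ} {n : ℕ}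
    (h : ∀ l : Fin 3, IsAuxPair D 𝒯 r (u (n - 1 + l), w (n - 1 + l))) :
    IsAuxPair D 𝒯 r (comb c u n, comb c w n) := by
  have e : (comb c u n, comb c w n) = comb c (fun k => (u k, w k)) n := by
    simp [comb, Fin.sum_univ_three]
  rw [e]
  exact comb_induction (fun x y hx hy => hx.add hD hy) (fun c x hx => hx.const_smul hD c) h

/-! ### The time grid -/

section TimeGrid

variable {T : ℝ} {M : ℕ} {t : ℕ → ℝ}

theorem IsTimeGrid.step_pos (ht : IsTimeGrid T M t) {n : ℕ} (hn : n < M) : 0 < step t n :=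
  sub_pos.2 (ht.2.2 n hn)

theorem IsTimeGrid.variability_bounds (ht : IsTimeGrid T M t) {n : ℕ} (hn : n < M) :
    -1 < variability t n ∧ variability t n < 1 := by
  have h1 := ht.step_pos hn
  have h0 := ht.step_pos (show n - 1 < M by omega)
  rw [variability]
  constructor
  · rw [lt_div_iff₀ (by linarith)]; linarith
  · rw [div_lt_iff₀ (by linarith)]; linarith

theorem IsTimeGrid.avgStep_pos (ht : IsTimeGrid T M t) {θ : ℝ} (hθ0 : 0 ≤ θ) (hθ1 : θ ≤ 1)
    {n : ℕ} (hn : n < M) : 0 < avgStep θ t n := by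
  have h1 := ht.step_pos hn
  have h0 := ht.step_pos (show n - 1 < M by omega)
  simp only [avgStep, α, Matrix.cons_val_zero, Matrix.cons_val]
  nlinarith

theorem IsTimeGrid.le_end (ht : IsTimeGrid T M t) {n : ℕ} (hn : n ≤ M) : t n ≤ T := by
  obtain ⟨-, hM, hlt⟩ := ht
  rw [← hM]
  refine Nat.decreasingInduction' (P := fun k => t k ≤ t M) (fun k hk _ h => ?_) hn le_rfl
  exact (hlt k hk).le.trans h

/-- The averaged steps telescope, since `α₂ - α₀ = 1`. -/
theorem IsTimeGrid.sum_avgStep_le (ht : IsTimeGrid T M t) {θ : ℝ} (hθ0 : 0 ≤ θ) (hθ1 : θ ≤ 1)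
    {k : ℕ} (hk : k < M) : ∑ n ∈ Finset.Icc 1 k, avgStep θ t n ≤ T := by
  have key : ∑ n ∈ Finset.Icc 1 k, avgStep θ t n
      = (1 + θ) / 2 * (t (k + 1) - t 1) + (1 - θ) / 2 * (t k - t 0) := by
    clear hk
    induction k with
    | zero => simp
    | succ k ih =>
      rw [Finset.sum_Icc_succ_top (by omega), ih]
      simp only [avgStep, α, step, Matrix.cons_val_zero, Matrix.cons_val, Nat.add_sub_cancel]
      ring
  have h1 : t (k + 1) ≤ T := ht.le_end hk
  have h2 : t k ≤ T := ht.le_end hk.le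
  have h3 : t 0 < t 1 := ht.2.2 0 (by omega)
  have h4 := ht.1
  rw [key]
  nlinarith

end TimeGrid

/-! ### Discrete Gronwall inequality -/

/-- A one-step growth bound with an implicit share `y n < 1` of the new energy accumulates to an
exponential factor, with no further constant in front of the data. -/
theorem discrete_gronwall {M : ℕ} {E d F x y z : ℕ → ℝ} {c : ℝ} (hE : ∀ n, 0 ≤ E n)
    (hd : ∀ n, 1 ≤ n → n < M → 0 ≤ d n) (hF : ∀ n, 1 ≤ n → n < M → 0 ≤ F n)
    (hcx : ∀ n, 1 ≤ n → n < M → 0 ≤ c * x n)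
    (hy : ∀ n, 1 ≤ n → n < M → 0 ≤ y n ∧ y n < 1) (hz : ∀ n, 1 ≤ n → n < M → 0 ≤ z n)
    (hyz : ∀ n, 1 ≤ n → n < M → 1 + z n ≤ Real.exp (c * x n) * (1 - y n))
    (hstep : ∀ n, 1 ≤ n → n < M →
      E (n + 1) + d n ≤ E n + F n + (y n * E (n + 1) + z n * E n)) {k : ℕ} (hk : k < M) :
    E (k + 1) + ∑ n ∈ Finset.Icc 1 k, d n
      ≤ Real.exp (c * ∑ n ∈ Finset.Icc 1 k, x n) * (E 1 + ∑ n ∈ Finset.Icc 1 k, F n) := by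
  induction k with
  | zero => simp
  | succ k ih =>
    have ih := ih (by omega)
    have hn : 1 ≤ k + 1 := by omega
    have hsum : ∀ g : ℕ → ℝ, (∀ n, 1 ≤ n → n < M → 0 ≤ g n) →
        0 ≤ ∑ n ∈ Finset.Icc 1 k, g n := fun g hg =>
      Finset.sum_nonneg fun n hn => hg n (Finset.mem_Icc.1 hn).1 (by
        have := (Finset.mem_Icc.1 hn).2; omega)
    have hdS := hsum d hd
    have hxS := hsum _ hcx
    rw [← Finset.mul_sum] at hxS
    simp only [Finset.sum_Icc_succ_top hn]
    set dS := ∑ n ∈ Finset.Icc 1 k, d n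
    set xS := ∑ n ∈ Finset.Icc 1 k, x n
    set FS := ∑ n ∈ Finset.Icc 1 k, F n
    have h := hstep (k + 1) hn hk
    obtain ⟨hy0, hy1⟩ := hy (k + 1) hn hk
    have hz0 := hz (k + 1) hn hk
    have hF0 := hF (k + 1) hn hk
    have hd0 := hd (k + 1) hn hk
    have hE1 := hE (k + 1)
    have hexp : 1 ≤ Real.exp (c * xS) := Real.one_le_exp hxS
    set S := E (k + 1) + dS with hS
    set S' := E (k + 1 + 1) + (dS + d (k + 1)) with hS'
    have hSF : 0 ≤ S + F (k + 1) := by positivity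
    have h1 : (1 - y (k + 1)) * S' ≤ (1 + z (k + 1)) * (S + F (k + 1)) := by
      have : 0 ≤ y (k + 1) * (dS + d (k + 1)) := by positivity
      have : 0 ≤ z (k + 1) * (dS + F (k + 1)) := by positivity
      rw [hS, hS']
      linarith
    have h2 : (1 - y (k + 1)) * S'
        ≤ (1 - y (k + 1)) * (Real.exp (c * x (k + 1)) * (S + F (k + 1))) := by
      refine h1.trans ((mul_le_mul_of_nonneg_right (hyz (k + 1) hn hk) hSF).trans (le_of_eq ?_))
      ring
    have h3 := le_of_mul_le_mul_left h2 (by linarith)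
    calc S' ≤ Real.exp (c * x (k + 1)) * (S + F (k + 1)) := h3
      _ ≤ Real.exp (c * x (k + 1))
          * (Real.exp (c * xS) * (E 1 + FS) + Real.exp (c * xS) * F (k + 1)) := by
        gcongr
        exact le_mul_of_one_le_left hF0 hexp
      _ = _ := by rw [mul_add c, Real.exp_add]; ring

/-! ### The energy estimate -/

/-- Young's inequality for the forcing term, whose velocity factor is controlled by the gradient. -/
theorem mul_sqrt_le_of_le_mul {C μ N G φ : ℝ} (hC : 0 < C) (hμ : 0 < μ) (hN : 0 ≤ N)
    (h : N ≤ C * G) : φ * √N ≤ μ / 2 * G + C / μ * φ ^ 2 := by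
  have e : μ / (2 * C) * (√N - C / μ * φ) ^ 2
      = μ / (2 * C) * √N ^ 2 - φ * √N + C / (2 * μ) * φ ^ 2 := by
    field_simp
    ring
  have h1 : 0 ≤ μ / (2 * C) * (√N - C / μ * φ) ^ 2 := by positivity
  have h2 : μ / (2 * C) * N ≤ μ / 2 * G := by
    calc _ ≤ μ / (2 * C) * (C * G) := by gcongr
      _ = _ := by field_simp
  have h3 : C / (2 * μ) * φ ^ 2 ≤ C / μ * φ ^ 2 := by gcongr; linarith
  rw [e, Real.sq_sqrt hN] at h1
  linarith

/-- The energy estimate of one step: the momentum equation is tested with `u_{n,β}`. -/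
theorem energy_step (hD : IsOpen D) {C : ℝ} (hC0 : 0 < C)
    (hC : ∀ v : Plane → Plane, MemX D v → normSq D v ≤ C * normSq D (grad D v))
    {P : Params} (hμ : 0 < P.μ)
    {θ : ℝ} (hθ0 : 0 ≤ θ) (hθ1 : θ ≤ 1) {T : ℝ} {M : ℕ} {t : ℕ → ℝ} (ht : IsTimeGrid T M t)
    {f : ℝ → Lp Plane 2 (volume.restrict D)} {u w : ℕ → Plane → Plane} {p : ℕ → Plane → ℝ}
    {n : ℕ} (hn : 1 ≤ n) (hnM : n < M)
    (hp : ∀ l : Fin 3, MemQh D 𝒯 r (p (n - 1 + l)))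
    (huw : ∀ l : Fin 3, IsAuxPair D 𝒯 r (u (n - 1 + l), w (n - 1 + l)))
    (hmom : MomentumEq P D 𝒯 r θ t f u w p n) :
    ((1 + θ) / 4 * normSq D (u (n + 1)) + (1 - θ) / 4 * normSq D (u n))
      + (normSq D (comb (a θ (variability t n)) u n)
        + avgStep θ t n * (P.μ / 2 * normSq D (grad D (atβ θ t u n))
            + P.γ * normSq D (atβ θ t w n) + P.lam * l4NormPow D (atβ θ t u n)))
    ≤ ((1 + θ) / 4 * normSq D (u n) + (1 - θ) / 4 * normSq D (u (n - 1)))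
      + C / P.μ * (avgStep θ t n * ‖atβ θ t (fun j => f (t j)) n‖ ^ 2)
      + |P.ρ| * avgStep θ t n * normSq D (atβ θ t u n) := by
  have hk := ht.avgStep_pos hθ0 hθ1 hnM
  obtain ⟨hε, -⟩ := ht.variability_bounds hnM
  have hβ : IsAuxPair D 𝒯 r (atβ θ t u n, atβ θ t w n) := isAuxPair_comb hD huw
  have hu : ∀ l : Fin 3, MemLp (u (n - 1 + l)) 2 (volume.restrict D) :=
    fun l => (huw l).mem_u.1.memLp
  have hcomb : ∀ c, MemLp (comb c u n) 2 (volume.restrict D) := memLp_comb hu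
  have hpβ : MemQh D 𝒯 r (atβ θ t p n) :=
    comb_induction (p := MemQh D 𝒯 r) (fun _ _ => MemQh.add) (fun c _ h => h.const_smul c) hp
  -- the individual terms of the tested equation
  have hα : ip D (atα θ u n) (atβ θ t u n)
      = ((1 + θ) / 4 * normSq D (u (n + 1)) + (1 - θ) / 4 * normSq D (u n))
        - ((1 + θ) / 4 * normSq D (u n) + (1 - θ) / 4 * normSq D (u (n - 1)))
        + normSq D (comb (a θ (variability t n)) u n) := by
    have h0 := hu 0
    have h1 := hu 1
    have h2 := hu 2
    simp only [Fin.val_zero, Fin.val_one, Fin.val_two, add_zero, Nat.sub_add_cancel hn,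
      show n - 1 + 2 = n + 1 by omega] at h0 h1 h2
    rw [atα, atβ, ← inner_toL2 (hcomb _) (hcomb _), toL2_comb hu, toL2_comb hu,
      inner_comb_α_comb_β hθ0 hθ1 hε _ hn, ← toL2_comb hu, norm_toL2_sq (hcomb _),
      norm_toL2_sq h0, norm_toL2_sq h1, norm_toL2_sq h2]
  have hγ : ip D (grad D (atβ θ t w n)) (grad D (atβ θ t u n)) = normSq D (atβ θ t w n) := by
    rw [ip_comm, ← hβ.aux _ hβ.mem_w, ip_self]
  have hlam : ip D (fun x => ‖atβ θ t u n x‖ ^ 2 • atβ θ t u n x) (atβ θ t u n)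
      = l4NormPow D (atβ θ t u n) := by
    simp only [ip, l4NormPow, real_inner_smul_left, real_inner_self_eq_norm_sq, ← pow_add]
  have hb : b D (atβ θ t u n) (atβ θ t u n) (atβ θ t u n) = 0 := sub_self _
  have hdiv : ip D (atβ θ t p n) (div D (atβ θ t u n)) = 0 := by
    rw [ip_comm, hβ.mem_u.2 _ hpβ]
  have heq := hmom _ hβ.mem_u.1
  rw [hα, ip_self, hγ, hb, ip_self, hlam, hdiv] at heq
  have hP := hC _ hβ.mem_u.1.2.1
  have hf := ip_coeFn_le (atβ θ t (fun j => f (t j)) n) hβ.mem_u.1.memLp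
  have hB0 := normSq_nonneg D (atβ θ t u n)
  have hR := hf.trans (mul_sqrt_le_of_le_mul hC0 hμ hB0 hP)
  have hρ : -(P.ρ * normSq D (atβ θ t u n)) ≤ |P.ρ| * normSq D (atβ θ t u n) := by
    rw [← neg_mul]
    exact mul_le_mul_of_nonneg_right (neg_le_abs _) hB0
  have hkey := mul_le_mul_of_nonneg_left (add_le_add hR hρ) hk.le
  rw [← heq] at hkey
  have hcancel := mul_one_div_cancel hk.ne'
  clear heq hf hR
  linear_combination hkey - hcancel * (
    ((1 + θ) / 4 * normSq D (u (n + 1)) + (1 - θ) / 4 * normSq D (u n))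
        - ((1 + θ) / 4 * normSq D (u n) + (1 - θ) / 4 * normSq D (u (n - 1)))
        + normSq D (comb (a θ (variability t n)) u n))

end ActiveFluid

/-! ### Boundedness in kinetic energy -/

theorem mainTheorem1 :
    ∃ Cexp : ℝ → ℝ, (∀ θ, 0 < Cexp θ) ∧
    ∀ D : Set ActiveFluid.Plane, IsOpen D → Bornology.IsBounded D →
    ∃ C : ℝ, 0 < C ∧
    ∀ (P : ActiveFluid.Params), 0 < P.μ → 0 ≤ P.γ → 0 ≤ P.ν → 0 ≤ P.lam →
    ∀ (𝒯 : Geometry.SimplicialComplex ℝ ActiveFluid.Plane), ActiveFluid.IsTriangulation D 𝒯 →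
    ∀ (r : ℕ), 1 ≤ r →
    ∀ (θ : ℝ), 0 ≤ θ → θ ≤ 1 →
    ∀ (T : ℝ) (M : ℕ) (t : ℕ → ℝ), ActiveFluid.IsTimeGrid T M t →
    ∀ (f : ℝ → Lp ActiveFluid.Plane 2 (volume.restrict D)),
      MemLp f 2 (volume.restrict (Set.Icc 0 T)) →
    ∀ (u w : ℕ → ActiveFluid.Plane → ActiveFluid.Plane) (p : ℕ → ActiveFluid.Plane → ℝ),
      ActiveFluid.IsSolution P D 𝒯 r θ M t f u w p →
      ActiveFluid.CompatibleStart D 𝒯 r u w →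
      (∀ n, 1 ≤ n → n < M →
        ActiveFluid.Cβ θ t n * |P.ρ| * ActiveFluid.avgStep θ t n ≤ (1 + θ) / 4) →
    ∀ m : ℕ, 1 < m → m ≤ M →
      (1 + θ) / 4 * ActiveFluid.normSq D (u m)
        + ∑ n ∈ Finset.Icc 1 (m - 1),
          (ActiveFluid.normSq D
              (ActiveFluid.comb (ActiveFluid.a θ (ActiveFluid.variability t n)) u n)
            + ActiveFluid.avgStep θ t n *
              (P.μ / 2 * ActiveFluid.normSq D (ActiveFluid.grad D (ActiveFluid.atβ θ t u n))
                + P.γ * ActiveFluid.normSq D (ActiveFluid.atβ θ t w n)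
                + P.lam * ActiveFluid.l4NormPow D (ActiveFluid.atβ θ t u n)))
      ≤ Real.exp (Cexp θ * |P.ρ| * T) *
          ((1 + θ) / 4 * ActiveFluid.normSq D (u 1)
            + (1 + θ) / 4 * ActiveFluid.normSq D (u 0)
            + C / P.μ * ∑ n ∈ Finset.Icc 1 (m - 1),
                ActiveFluid.avgStep θ t n *
                  ‖ActiveFluid.atβ θ t (fun j => f (t j)) n‖ ^ 2) := by
  choose Cexp hCpos hCexp using ActiveFluid.exists_absorb
  refine ⟨Cexp, hCpos, fun D hD hb => ?_⟩
  obtain ⟨C, hC0, hC⟩ := ActiveFluid.exists_normSq_le_grad hb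
  refine ⟨C, hC0, ?_⟩
  intro P hμ hγ _ hlam 𝒯 _ r _ θ hθ0 hθ1 T M t ht f _ u w p hsol hstart hsmall m hm1 hmM
  -- the constraints hold at all levels: at `0`, `1` by the start, later by the scheme
  have hpair : ∀ n ≤ M, ActiveFluid.IsAuxPair D 𝒯 r (u n, w n) := by
    intro n hn
    have haux : ActiveFluid.AuxEq D 𝒯 r (u n) (w n) ∧ ActiveFluid.DivEq D 𝒯 r (u n) := by
      rcases le_or_gt n 1 with h | h
      · exact hstart n h
      · obtain ⟨k, rfl⟩ : ∃ k, n = k + 1 := ⟨n - 1, by omega⟩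
        exact ⟨hsol.aux k (by omega) (by omega), hsol.divFree k (by omega) (by omega)⟩
    exact ⟨⟨hsol.mem_u n hn, haux.2⟩, hsol.mem_w n hn, haux.1⟩
  have hlev : ∀ n, 1 ≤ n → n < M → ∀ l : Fin 3, n - 1 + l ≤ M := fun n hn hnM l => by omega
  have hL2 : ∀ n ≤ M, MemLp (u n) 2 (volume.restrict D) := fun n hn => (hpair n hn).mem_u.1.memLp
  have hnn : 0 ≤ 1 - θ := by linarith
  have hN : ∀ n, 0 ≤ ActiveFluid.normSq D (u n) := fun n => ActiveFluid.normSq_nonneg D _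
  have hx : ∀ n, n < M → 0 ≤ |P.ρ| * ActiveFluid.avgStep θ t n := fun n hn =>
    mul_nonneg (abs_nonneg _) (ht.avgStep_pos hθ0 hθ1 hn).le
  -- the shares `y n`, `z n` of the energies at the levels `n + 1`, `n` that bound the `ρ`-term
  have hyz : ∀ n, ∃ y z : ℝ, 1 ≤ n → n < M → 0 ≤ y ∧ y < 1 ∧ 0 ≤ z ∧
      1 + z ≤ Real.exp (Cexp θ * (|P.ρ| * ActiveFluid.avgStep θ t n)) * (1 - y) ∧
      |P.ρ| * ActiveFluid.avgStep θ t n * ActiveFluid.normSq D (ActiveFluid.atβ θ t u n)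
        ≤ y * ((1 + θ) / 4 * ActiveFluid.normSq D (u (n + 1))
            + (1 - θ) / 4 * ActiveFluid.normSq D (u n))
          + z * ((1 + θ) / 4 * ActiveFluid.normSq D (u n)
            + (1 - θ) / 4 * ActiveFluid.normSq D (u (n - 1))) := by
    intro n
    by_cases hn : 1 ≤ n ∧ n < M
    swap
    · exact ⟨0, 0, fun h1 h2 => absurd ⟨h1, h2⟩ hn⟩
    obtain ⟨hε0, hε1⟩ := ht.variability_bounds hn.2
    have hs := hsmall n hn.1 hn.2
    rw [mul_assoc, ActiveFluid.Cβ] at hs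
    obtain ⟨y, z, hy0, hy1, hz, hexp, h⟩ :=
      hCexp θ hθ0 hθ1 _ hε0 hε1 _ (hx n hn.2) hs
    refine ⟨y, z, fun _ _ => ⟨hy0, hy1, hz, hexp, ?_⟩⟩
    have hu : ∀ l : Fin 3, MemLp (u (n - 1 + l)) 2 (volume.restrict D) :=
      fun l => hL2 _ (hlev n hn.1 hn.2 l)
    have hβ : MemLp (ActiveFluid.atβ θ t u n) 2 (volume.restrict D) := ActiveFluid.memLp_comb hu _
    have h' := h _ (fun k => ActiveFluid.toL2 D (u k)) n hn.1
    rwa [← ActiveFluid.toL2_comb hu, ← ActiveFluid.atβ, ActiveFluid.norm_toL2_sq hβ,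
      ActiveFluid.norm_toL2_sq (hL2 (n + 1) hn.2), ActiveFluid.norm_toL2_sq (hL2 n hn.2.le),
      ActiveFluid.norm_toL2_sq (hL2 (n - 1) (by omega))] at h'
  choose y z hyz using hyz
  -- the levels are shifted by one, so that the sums over `1, …, m - 1` read `1, …, k`
  obtain ⟨k, rfl⟩ : ∃ k, m = k + 1 := ⟨m - 1, by omega⟩
  have hG := ActiveFluid.discrete_gronwall (M := M)
    (E := fun n => (1 + θ) / 4 * ActiveFluid.normSq D (u n)
      + (1 - θ) / 4 * ActiveFluid.normSq D (u (n - 1)))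
    (d := fun n => ActiveFluid.normSq D
        (ActiveFluid.comb (ActiveFluid.a θ (ActiveFluid.variability t n)) u n)
      + ActiveFluid.avgStep θ t n *
        (P.μ / 2 * ActiveFluid.normSq D (ActiveFluid.grad D (ActiveFluid.atβ θ t u n))
          + P.γ * ActiveFluid.normSq D (ActiveFluid.atβ θ t w n)
          + P.lam * ActiveFluid.l4NormPow D (ActiveFluid.atβ θ t u n)))
    (F := fun n => C / P.μ * (ActiveFluid.avgStep θ t n *
      ‖ActiveFluid.atβ θ t (fun j => f (t j)) n‖ ^ 2))
    (x := fun n => |P.ρ| * ActiveFluid.avgStep θ t n) (y := y) (z := z) (c := Cexp θ)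
    (fun n => by have := hN n; have := hN (n - 1); positivity)
    (fun n _ hn => by
      have h1 := (ht.avgStep_pos hθ0 hθ1 hn).le
      have h2 := ActiveFluid.normSq_nonneg D
        (ActiveFluid.comb (ActiveFluid.a θ (ActiveFluid.variability t n)) u n)
      have h3 := ActiveFluid.normSq_nonneg D (ActiveFluid.grad D (ActiveFluid.atβ θ t u n))
      have h4 := ActiveFluid.normSq_nonneg D (ActiveFluid.atβ θ t w n)
      have h5 : 0 ≤ ActiveFluid.l4NormPow D (ActiveFluid.atβ θ t u n) :=
        integral_nonneg fun _ => by positivity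
      positivity)
    (fun n _ hn => by have := (ht.avgStep_pos hθ0 hθ1 hn).le; positivity)
    (fun n _ hn => mul_nonneg (hCpos θ).le (hx n hn))
    (fun n h1 h2 => ⟨(hyz n h1 h2).1, (hyz n h1 h2).2.1⟩)
    (fun n h1 h2 => (hyz n h1 h2).2.2.1) (fun n h1 h2 => (hyz n h1 h2).2.2.2.1)
    (fun n h1 h2 => (ActiveFluid.energy_step hD hC0 hC hμ hθ0 hθ1 ht h1 h2
        (fun l => hsol.mem_p _ (hlev n h1 h2 l)) (fun l => hpair _ (hlev n h1 h2 l))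
        (hsol.momentum n h1 h2)).trans (add_le_add le_rfl (hyz n h1 h2).2.2.2.2))
    (k := k) (by omega)
  simp only [Nat.add_sub_cancel, ← Finset.mul_sum, Nat.sub_self] at hG ⊢
  have hFS : 0 ≤ C / P.μ * ∑ n ∈ Finset.Icc 1 k, ActiveFluid.avgStep θ t n *
      ‖ActiveFluid.atβ θ t (fun j => f (t j)) n‖ ^ 2 := by
    refine mul_nonneg (by positivity) (Finset.sum_nonneg fun n hn => ?_)
    have := (ht.avgStep_pos hθ0 hθ1 (n := n) (by have := (Finset.mem_Icc.1 hn).2; omega)).le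
    positivity
  have hsumT := ht.sum_avgStep_le hθ0 hθ1 (k := k) (by omega)
  have h0 := hN 0
  have h1 := hN 1
  have hk0 : 0 ≤ (1 - θ) / 4 * ActiveFluid.normSq D (u k) := by have := hN k; positivity
  refine (le_trans ?_ hG).trans ?_
  · linarith
  · have hc := (hCpos θ).le
    rw [mul_assoc (Cexp θ)]
    gcongr
    linarith
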